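/- Let $(R,\mathfrak m)$ be a Noetherian Cohen–Macaulay local ring of Krull dimension $2$ and let $I$ be an $\mathfrak m$-primary ideal of $R$. An ideal $J\subseteq I$ is a reduction of $I$ if $JI^n=I^{n+1}$ for some $n\ge 0$; it is a minimal reduction if it is minimal under inclusion among the reductions of $I$. For a reduction $J$ of $I$ let $\operatorname{rd}_J(I)$ be the least $n\ge 0$ with $JI^n=I^{n+1}$, and let $\operatorname{rd}(I)$ be the minimum of $\operatorname{rd}_J(I)$ over all minimal reductions $J$ of $I$. For $n\in\mathbb Z$ let $H_I(n)$ be the length of $R/I^n$ (with $I^n=R$ for $n\le 0$), let $P_I$ be the Hilbert–Samuel polynomial, i.e. the polynomial with $P_I(n)=H_I(n)$ for all large $n$, and let $\operatorname{n}(I)=\min\{n\in\mathbb Z: P_I(t)=H_I(t)\text{ for all integers } t>n\}$ be the postulation number. Write $\widetilde{K}=\bigcup_{n\ge 1}(K^{n+1}:K^n)$ for the Ratliff–Rush closure of an ideal $K$, and let $\rho(I)=\min\{i\ge 1:\widetilde{I^n}=I^n\text{ for all } n\ge i\}$. An element $x\in I$ is superficial for $I$ if there is a positive integer $c$ such that $(I^{n+1}:x)\cap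 I^c=I^n$ for all $n\ge c$. Let $J=(x,y)$ be a minimal reduction of $I$ such that $x$ is superficial for $I$. If $\operatorname{n}(I)=\rho(I)-1$, then $$\operatorname{rd}(I)\le \operatorname{n}(I)+2 \qquad\text{and}\qquad \operatorname{rd}_J(I)\le\rho(I)+1 .$$ -/

import Mathlib

noncomputable section

open Polynomial

namespace HilbertSamuel

/-- The depth of a local ring: the supremum of the lengths of the regular sequences
contained in the maximal ideal. -/
def depth (R : Type*) [CommRing R] [IsLocalRing R] : ℕ∞ :=
  ⨆ rs ∈ {rs : List R | RingTheory.Sequence.IsRegular R rs ∧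
    ∀ r ∈ rs, r ∈ IsLocalRing.maximalIdeal R}, (rs.length : ℕ∞)

/-- A Cohen-Macaulay local ring: a Noetherian local ring whose depth equals its Krull
dimension. -/
structure IsCohenMacaulayLocal (R : Type*) [CommRing R] [IsLocalRing R] : Prop where
  noetherian : IsNoetherianRing R
  depth_eq_dim : (depth R : WithBot ℕ∞) = ringKrullDim R

variable {R : Type*} [CommRing R]

/-- `I` is primary to the maximal ideal of the local ring `R`. -/
def IsMPrimary [IsLocalRing R] (I : Ideal R) : Prop :=
  I.IsPrimary ∧ I.radical = IsLocalRing.maximalIdeal R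

/-- `J` is a reduction of `I`. -/
def IsReduction (I J : Ideal R) : Prop :=
  J ≤ I ∧ ∃ n : ℕ, J * I ^ n = I ^ (n + 1)

/-- `J` is a minimal reduction of `I`: minimal for inclusion among all reductions of `I`. -/
def IsMinimalReduction (I J : Ideal R) : Prop :=
  Minimal (IsReduction I) J

/-- The reduction number `rd_J(I)` of `I` with respect to a reduction `J`. -/
def reductionNumberWrt (I J : Ideal R) : ℕ :=
  sInf {n : ℕ | J * I ^ n = I ^ (n + 1)}

/-- The reduction number `rd(I)`: the minimum of `rd_J(I)` over all minimal reductions `J`. -/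
def reductionNumber (I : Ideal R) : ℕ :=
  sInf {k : ℕ | ∃ J : Ideal R, IsMinimalReduction I J ∧ reductionNumberWrt I J = k}

/-- The Hilbert-Samuel function `H_I(n) = λ(R / I ^ n)`, where `I ^ n = R` for `n ≤ 0`. -/
def hilbertFunction (I : Ideal R) (n : ℤ) : ℕ :=
  (Module.length R (R ⧸ I ^ n.toNat)).toNat

/-- `P` agrees with the Hilbert-Samuel function of `I` at all large integers. -/
def IsHilbertPolynomial (I : Ideal R) (P : ℚ[X]) : Prop :=
  ∃ N : ℤ, ∀ n : ℤ, N ≤ n → P.eval (n : ℚ) = (hilbertFunction I n : ℚ)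

/-- There is at most one Hilbert-Samuel polynomial. -/
theorem IsHilbertPolynomial.unique {I : Ideal R} {P Q : ℚ[X]}
    (hP : IsHilbertPolynomial I P) (hQ : IsHilbertPolynomial I Q) : P = Q := by
  obtain ⟨N, hN⟩ := hP
  obtain ⟨M, hM⟩ := hQ
  refine Polynomial.eq_of_infinite_eval_eq P Q ?_
  refine ((Set.Ici_infinite (max N M)).image
    (f := fun n : ℤ => (n : ℚ)) (Int.cast_injective.injOn)).mono ?_
  rintro _ ⟨n, hn, rfl⟩
  have h1 : N ≤ n := (le_max_left N M).trans hn
  have h2 : M ≤ n := (le_max_right N M).trans hn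
  change P.eval (n : ℚ) = Q.eval (n : ℚ)
  rw [hN n h1, hM n h2]

open Classical in
/-- The Hilbert-Samuel polynomial `P_I` (it exists whenever `I` is primary to the maximal ideal
of a Noetherian local ring; the value where it does not exist is a convention). -/
def hilbertPolynomial (I : Ideal R) : ℚ[X] :=
  if h : ∃ P : ℚ[X], IsHilbertPolynomial I P then h.choose else 0

/-- The postulation number
`n(I) = min {n ∈ ℤ : P_I(t) = H_I(t) for all integers t > n}`. -/
def postulationNumber (I : Ideal R) : ℤ :=
  sInf {n : ℤ | ∀ t : ℤ, n < t →
    (hilbertPolynomial I).eval (t : ℚ) = (hilbertFunction I t : ℚ)}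

/-- The Ratliff-Rush closure, the union of the increasing chain of the ideals
`(I ^ (n + 1) : I ^ n)` for `n ≥ 1`. -/
def ratliffRush (I : Ideal R) : Ideal R :=
  ⨆ n ∈ {n : ℕ | 1 ≤ n}, Submodule.colon (I ^ (n + 1)) ((I ^ n : Ideal R) : Set R)

/-- The stability index `ρ(I)` of the Ratliff-Rush filtration. -/
def stabilityIndex (I : Ideal R) : ℕ :=
  sInf {i : ℕ | 1 ≤ i ∧ ∀ n : ℕ, i ≤ n → ratliffRush (I ^ n) = I ^ n}

/-- `x` is a superficial element for `I`. -/
def IsSuperficial (I : Ideal R) (x : R) : Prop :=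
  x ∈ I ∧ ∃ c : ℕ, 0 < c ∧ ∀ n : ℕ, c ≤ n →
    Submodule.colon (I ^ (n + 1)) {x} ⊓ I ^ c = I ^ n

end HilbertSamuel

end

/-! Depth two forces every syzygy of `x, y` to be a Koszul one. This gives an exact sequence
relating `R ⧸ J K`, `R ⧸ (K : J)`, two copies of `R ⧸ K`, and `R ⧸ J`. Take K = I^(n+1) and write e
= λ(R/J): then λ(R/J I^(n+1)) = e + 2 H(n+1) - λ(R/(I^(n+1) : J)) (`length_quotient_mul_add`). The
colon always lies in the Ratliff-Rush closure of I^n when n ≥ 1, so it equals I^n once n ≥ ρ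
(`colon_eq_pow`).

For large n, J I^(n+1) = I^(n+2), so H eventually has constant second difference e, and its
polynomial P has second difference e everywhere. The hypothesis n(I) = ρ - 1 says that P = H from ρ
onwards, so H(ρ+2) = e + 2 H(ρ+1) - H(ρ) = λ(R/J I^(ρ+1)). The inclusion J I^(ρ+1) ⊆ I^(ρ+2) is then
an equality, which gives both bounds. Superficiality of x ensures that ρ is attained. -/

namespace HilbertSamuel

/-! ### Regular sequences and syzygies of two elements -/

section Regular

variable {R : Type*} [CommRing R]

/-- If `g` is a nonzerodivisor modulo the nonzerodivisor `f`, it is one modulo each `f ^ n`. -/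
theorem dvd_of_pow_dvd_mul {f g : R} (hf : ∀ u, f * u = 0 → u = 0)
    (hg : ∀ u, f ∣ g * u → f ∣ u) (n : ℕ) : ∀ u, f ^ n ∣ g * u → f ^ n ∣ u := by
  induction n with
  | zero => simp
  | succ n ih =>
    rintro u ⟨v, hv⟩
    obtain ⟨w, rfl⟩ := hg u ⟨f ^ n * v, by rw [hv]; ring⟩
    have h : g * w = f ^ n * v := by
      rw [← sub_eq_zero]
      apply hf
      linear_combination hv
    obtain ⟨t, rfl⟩ := ih w ⟨v, h⟩
    exact ⟨t, by ring⟩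

theorem dvd_of_dvd_pow_mul {f g : R} (hg : ∀ u, f ∣ g * u → f ∣ u) (n : ℕ) :
    ∀ u, f ∣ g ^ n * u → f ∣ u := by
  induction n with
  | zero => simp
  | succ n ih =>
    intro u hu
    exact hg u (ih _ (by rwa [pow_succ, mul_assoc] at hu))

theorem eq_zero_of_pow_mul_eq_zero {f : R} (hf : ∀ u, f * u = 0 → u = 0) (n : ℕ) :
    ∀ u, f ^ n * u = 0 → u = 0 := by
  induction n with
  | zero => simp
  | succ n ih =>
    intro u hu
    exact hf u (ih _ (by rwa [pow_succ, mul_assoc] at hu))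

/-- Depth sensitivity of the Koszul complex on two elements: if the ideal `(x, y)` contains a
regular sequence of length two, then all syzygies of `x, y` are trivial. -/
theorem exists_koszul_syzygy {x y f g : R} (hfJ : f ∈ Ideal.span {x, y})
    (hgJ : g ∈ Ideal.span {x, y}) (hf : ∀ u, f * u = 0 → u = 0)
    (hg : ∀ u, f ∣ g * u → f ∣ u) {p q : R} (hpq : x * p + y * q = 0) :
    ∃ c, p = y * c ∧ q = -(x * c) := by
  obtain ⟨a, b, hab⟩ := Ideal.mem_span_pair.mp hfJ
  obtain ⟨a', b', hab'⟩ := Ideal.mem_span_pair.mp hgJ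
  have hfp : f * p = y * (b * p - a * q) := by
    rw [← hab]; linear_combination a * hpq
  have hfq : f * q = -(x * (b * p - a * q)) := by
    rw [← hab]; linear_combination b * hpq
  have hgp : g * p = y * (b' * p - a' * q) := by
    rw [← hab']; linear_combination a' * hpq
  have hgq : g * q = -(x * (b' * p - a' * q)) := by
    rw [← hab']; linear_combination b' * hpq
  -- With d = bp - aq and d' = b'p - a'q, the element gd - fd' is killed by x and y, hence by f, so
  -- gd = fd'. Thus f divides d, and c = d/f is the coefficient sought.
  obtain ⟨c, hc⟩ := hg (b * p - a * q) ⟨b' * p - a' * q, by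
    rw [← sub_eq_zero]
    apply hf
    have hx : x * (g * (b * p - a * q) - f * (b' * p - a' * q)) = 0 := by
      linear_combination g * hfq - f * hgq
    have hy : y * (g * (b * p - a * q) - f * (b' * p - a' * q)) = 0 := by
      linear_combination f * hgp - g * hfp
    nth_rewrite 1 [← hab]
    linear_combination a * hx + b * hy⟩
  refine ⟨c, ?_, ?_⟩
  · rw [← sub_eq_zero]
    apply hf
    linear_combination hfp + y * hc
  · rw [← sub_eq_zero]
    apply hf
    linear_combination hfq - x * hc

variable [IsLocalRing R]

open scoped Pointwise in
theorem exists_regular_pair (hd : 2 ≤ depth R) :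
    ∃ a ∈ IsLocalRing.maximalIdeal R, ∃ b ∈ IsLocalRing.maximalIdeal R,
      (∀ u, a * u = 0 → u = 0) ∧ ∀ u, a ∣ b * u → a ∣ u := by
  have h1 : (1 : ℕ∞) < depth R := lt_of_lt_of_le (by norm_num) hd
  unfold depth at h1
  simp only [lt_iSup_iff, Set.mem_ofPred_eq] at h1
  obtain ⟨rs, ⟨hreg, hmem⟩, hlen⟩ := h1
  match rs, hreg, hmem, hlen with
  | [], _, _, hlen => simp at hlen
  | [a], _, _, hlen => simp at hlen
  | a :: b :: t, hreg, hmem, _ =>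
    refine ⟨a, hmem a (by simp), b, hmem b (by simp), ?_, ?_⟩
    · have h := ((RingTheory.Sequence.isWeaklyRegular_cons_iff R _ _).mp hreg.toIsWeaklyRegular).1
      intro u hu
      exact isSMulRegular_iff_right_eq_zero_of_smul.mp h u hu
    · have h := ((RingTheory.Sequence.isWeaklyRegular_cons_iff _ _ _).mp
        ((RingTheory.Sequence.isWeaklyRegular_cons_iff R _ _).mp hreg.toIsWeaklyRegular).2).1
      intro u ⟨v, hv⟩
      have hu := (isSMulRegular_quotient_iff_mem_of_smul_mem (a • (⊤ : Submodule R R)) b).mp h u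
        (by
          rw [smul_eq_mul, hv]
          exact Submodule.smul_mem_pointwise_smul v a ⊤ trivial)
      obtain ⟨w, -, hw⟩ := (Submodule.mem_smul_pointwise_iff_exists u a ⊤).mp hu
      exact ⟨w, hw.symm⟩

/-- In a local ring of depth at least two, generators of a two-generated ideal containing a power
of the maximal ideal have only trivial syzygies. -/
theorem exists_koszul_syzygy_of_depth (hd : 2 ≤ depth R) {x y : R} {k : ℕ}
    (hk : IsLocalRing.maximalIdeal R ^ k ≤ Ideal.span {x, y}) {p q : R}
    (hpq : x * p + y * q = 0) : ∃ c, p = y * c ∧ q = -(x * c) := by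
  obtain ⟨a, ha, b, hb, hra, hrb⟩ := exists_regular_pair hd
  exact exists_koszul_syzygy (hk (Ideal.pow_mem_pow ha k)) (hk (Ideal.pow_mem_pow hb k))
    (eq_zero_of_pow_mul_eq_zero hra k)
    (dvd_of_dvd_pow_mul (dvd_of_pow_dvd_mul hra hrb k) k) hpq

/-- Nakayama for N = (0 : x): if u is in N, then (u, 0) is a syzygy, so u = yc with c again in N,
whence N ⊆ 𝔪N. -/
theorem eq_zero_of_mul_eq_zero_of_koszul [IsNoetherianRing R] {x y : R}
    (hy : y ∈ IsLocalRing.maximalIdeal R)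
    (hK : ∀ p q, x * p + y * q = 0 → ∃ c, p = y * c ∧ q = -(x * c)) {z : R}
    (hz : x * z = 0) : z = 0 := by
  let N : Ideal R := LinearMap.ker (LinearMap.mulLeft R x)
  have hN : N = ⊥ := by
    refine Submodule.eq_bot_of_le_smul_of_le_jacobson_bot (IsLocalRing.maximalIdeal R) N
      (IsNoetherian.noetherian _) ?_ (IsLocalRing.maximalIdeal_le_jacobson _)
    intro u hu
    have hu' : x * u = 0 := hu
    obtain ⟨c, rfl, hc⟩ := hK u 0 (by simpa using hu')
    exact Submodule.smul_mem_smul hy (show x * c = 0 by simpa using hc)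
  have : z ∈ N := hz
  simpa [hN] using this

end Regular

/-! ### Lengths of quotients -/

section Length

variable {R : Type*} [CommRing R]

/-- The length count coming from the exact sequence
`0 → R ⧸ (K : J) → (R ⧸ K)² → R ⧸ J K → R ⧸ J → 0` for `J = (x, y)`. -/
theorem length_quotient_mul_add {x y : R} (K : Ideal R)
    (hK : ∀ p q, x * p + y * q = 0 → ∃ c, p = y * c ∧ q = -(x * c)) :
    Module.length R (R ⧸ Ideal.span {x, y} * K) +
      Module.length R (R ⧸ Submodule.colon K (Ideal.span {x, y} : Ideal R)) =
    Module.length R (R ⧸ Ideal.span {x, y}) +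
      (Module.length R (R ⧸ K) + Module.length R (R ⧸ K)) := by
  set J : Ideal R := Ideal.span {x, y} with hJ
  have hxJ : x ∈ J := Ideal.subset_span (by simp)
  have hyJ : y ∈ J := Ideal.subset_span (by simp)
  have hxK : K ≤ Submodule.comap (LinearMap.mulLeft R x) (J * K) :=
    fun k hk => Ideal.mul_mem_mul hxJ hk
  have hyK : K ≤ Submodule.comap (LinearMap.mulLeft R y) (J * K) :=
    fun k hk => Ideal.mul_mem_mul hyJ hk
  let φ : (R ⧸ K) × (R ⧸ K) →ₗ[R] R ⧸ J * K :=
    (Submodule.mapQ K (J * K) (LinearMap.mulLeft R x) hxK).coprod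
      (Submodule.mapQ K (J * K) (LinearMap.mulLeft R y) hyK)
  have hφ : ∀ a b : R, φ (K.mkQ a, K.mkQ b) = (J * K).mkQ (x * a + y * b) := by
    intro a b
    rw [map_add]
    rfl
  have hcol : Submodule.colon K (J : Set R) ≤
      LinearMap.ker (K.mkQ.comp (LinearMap.mulLeft R y)) ⊓
        LinearMap.ker (K.mkQ.comp (LinearMap.mulLeft R (-x))) := by
    intro r hr
    rw [Submodule.mem_colon] at hr
    have h1 := hr x hxJ
    have h2 := hr y hyJ
    simp only [smul_eq_mul] at h1 h2
    simp only [Submodule.mem_inf, LinearMap.mem_ker, LinearMap.comp_apply,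
      LinearMap.mulLeft_apply, Submodule.mkQ_apply, Submodule.Quotient.mk_eq_zero]
    exact ⟨by rwa [mul_comm], by rw [neg_mul, mul_comm]; exact K.neg_mem h1⟩
  let ψ₀ : R →ₗ[R] (R ⧸ K) × (R ⧸ K) :=
    (K.mkQ.comp (LinearMap.mulLeft R y)).prod (K.mkQ.comp (LinearMap.mulLeft R (-x)))
  have hker : LinearMap.ker ψ₀ = Submodule.colon K (J : Set R) := by
    refine le_antisymm ?_ (by rw [LinearMap.ker_prod]; exact hcol)
    intro r hr
    simp only [ψ₀, LinearMap.ker_prod, Submodule.mem_inf, LinearMap.mem_ker, LinearMap.comp_apply,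
      LinearMap.mulLeft_apply, Submodule.mkQ_apply, Submodule.Quotient.mk_eq_zero] at hr
    rw [Submodule.mem_colon]
    intro s hs
    obtain ⟨a, b, rfl⟩ := Ideal.mem_span_pair.mp hs
    have h1 : y * r ∈ K := hr.1
    have h2 : x * r ∈ K := by simpa using K.neg_mem hr.2
    have : r • (a * x + b * y) = a * (x * r) + b * (y * r) := by rw [smul_eq_mul]; ring
    rw [this]
    exact K.add_mem (K.mul_mem_left _ h2) (K.mul_mem_left _ h1)
  -- Exactness in the middle: after correction by elements of K, a relation modulo J K becomes a
  -- true syzygy, hence a Koszul one.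
  have hrange : LinearMap.range ψ₀ = LinearMap.ker φ := by
    apply le_antisymm
    · rintro _ ⟨r, rfl⟩
      change φ (K.mkQ (y * r), K.mkQ (-x * r)) = 0
      rw [hφ, show x * (y * r) + y * (-x * r) = 0 by ring, map_zero]
    · rintro ⟨a, b⟩ hab
      obtain ⟨a, rfl⟩ := K.mkQ_surjective a
      obtain ⟨b, rfl⟩ := K.mkQ_surjective b
      rw [LinearMap.mem_ker, hφ, Submodule.mkQ_apply, Submodule.Quotient.mk_eq_zero] at hab
      rw [hJ, Ideal.span_insert, Ideal.sup_mul] at hab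
      obtain ⟨_, h1, _, h2, h12⟩ := Submodule.mem_sup.mp hab
      obtain ⟨k₁, hk₁, rfl⟩ := Ideal.mem_span_singleton_mul.mp h1
      obtain ⟨k₂, hk₂, rfl⟩ := Ideal.mem_span_singleton_mul.mp h2
      obtain ⟨c, hc₁, hc₂⟩ := hK (a - k₁) (b - k₂) (by linear_combination -h12)
      refine ⟨c, Prod.ext ?_ ?_⟩
      · change K.mkQ (y * c) = K.mkQ a
        rw [← hc₁]
        exact (Submodule.Quotient.eq K).mpr (by simpa using hk₁)
      · change K.mkQ (-x * c) = K.mkQ b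
        rw [neg_mul, ← hc₂]
        exact (Submodule.Quotient.eq K).mpr (by simpa using hk₂)
  have e1 : Module.length R ((R ⧸ K) × (R ⧸ K)) =
      Module.length R (LinearMap.ker φ) + Module.length R (LinearMap.range φ) :=
    Module.length_eq_add_of_exact (LinearMap.ker φ).subtype φ.rangeRestrict
      (Submodule.subtype_injective _) φ.surjective_rangeRestrict
      (by
        rw [LinearMap.exact_iff, LinearMap.ker_rangeRestrict, Submodule.range_subtype])
  have e2 : Module.length R (LinearMap.ker φ) =
      Module.length R (R ⧸ Submodule.colon K (J : Set R)) := by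
    rw [← hrange, ← hker]
    exact (LinearMap.quotKerEquivRange ψ₀).length_eq.symm
  have e3 : Module.length R (R ⧸ J * K) =
      Module.length R (LinearMap.range φ) + Module.length R (R ⧸ J) := by
    refine Module.length_eq_add_of_exact (LinearMap.range φ).subtype
      (Submodule.factor (Ideal.mul_le_inf.trans inf_le_left : J * K ≤ J))
      (Submodule.subtype_injective _) (Submodule.factor_surjective _) ?_
    rw [LinearMap.exact_iff, Submodule.range_subtype]
    apply le_antisymm
    · intro z hz
      obtain ⟨z, rfl⟩ := (J * K).mkQ_surjective z
      have hzJ : z ∈ J := (Submodule.Quotient.mk_eq_zero J).mp hz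
      obtain ⟨a, b, rfl⟩ := Ideal.mem_span_pair.mp hzJ
      exact ⟨(K.mkQ a, K.mkQ b), by rw [hφ]; congr 1; ring⟩
    · rintro _ ⟨⟨a, b⟩, rfl⟩
      obtain ⟨a, rfl⟩ := K.mkQ_surjective a
      obtain ⟨b, rfl⟩ := K.mkQ_surjective b
      rw [LinearMap.mem_ker, hφ]
      exact (Submodule.Quotient.mk_eq_zero J).mpr <| J.add_mem (J.mul_mem_right _ hxJ) (J.mul_mem_right _ hyJ)
  rw [← Module.length_prod R (R ⧸ K) (R ⧸ K), e1, e2, e3]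
  ring

theorem length_quotient_ne_top [IsLocalRing R] [IsNoetherianRing R] {K : Ideal R} {k : ℕ}
    (hk : IsLocalRing.maximalIdeal R ^ k ≤ K) : Module.length R (R ⧸ K) ≠ ⊤ := by
  rcases eq_or_ne K ⊤ with rfl | hne
  · rw [Module.length_eq_zero]
    exact ENat.zero_ne_top
  have : Nontrivial (R ⧸ K) := Ideal.Quotient.nontrivial_iff.mpr hne
  have : IsLocalRing (R ⧸ K) :=
    IsLocalRing.of_surjective' (Ideal.Quotient.mk K) Ideal.Quotient.mk_surjective
  have hart : IsArtinianRing (R ⧸ K) := by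
    rw [isArtinianRing_iff_isNilpotent_maximalIdeal]
    refine ⟨k, ?_⟩
    rw [← IsLocalRing.map_maximalIdeal_of_surjective (Ideal.Quotient.mk K)
      Ideal.Quotient.mk_surjective, ← Ideal.map_pow, Ideal.zero_eq_bot, Ideal.map_eq_bot_iff_le_ker,
      Ideal.mk_ker]
    exact hk
  rw [Module.length_eq_of_surjective (S := R) (R := R ⧸ K) (M := R ⧸ K)
    Ideal.Quotient.mk_surjective]
  exact Module.length_ne_top

theorem eq_of_le_of_length_quotient_eq {A B : Ideal R} (hAB : A ≤ B)
    (hfin : Module.length R (R ⧸ B) ≠ ⊤)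
    (h : Module.length R (R ⧸ A) = Module.length R (R ⧸ B)) : A = B := by
  have e := Module.length_eq_add_of_exact (LinearMap.ker (Submodule.factor hAB)).subtype
    (Submodule.factor hAB) (Submodule.subtype_injective _) (Submodule.factor_surjective hAB)
    (by rw [LinearMap.exact_iff, Submodule.range_subtype])
  rw [h] at e
  have h0 : Module.length R (LinearMap.ker (Submodule.factor hAB)) = 0 := by
    refine (ENat.addLECancellable_of_ne_top hfin).inj_left.mp ?_
    rw [zero_add]
    exact e.symm
  rw [Module.length_eq_zero_iff, Submodule.subsingleton_iff_eq_bot] at h0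
  refine le_antisymm hAB fun b hb => ?_
  have hb' : A.mkQ b ∈ LinearMap.ker (Submodule.factor hAB) := by
    exact (Submodule.Quotient.mk_eq_zero B).mpr hb
  rw [h0] at hb'
  exact (Submodule.Quotient.mk_eq_zero A).mp hb'

end Length

/-! ### Hilbert-Samuel polynomial and postulation number -/

section HilbertPolynomial

open Polynomial

variable {R : Type*} [CommRing R]

/-- A function on the integers whose second differences are eventually constant is eventually a
polynomial, and that polynomial has the same second differences everywhere. -/
theorem exists_polynomial_of_second_difference {h : ℤ → ℚ} {e : ℚ} {N : ℤ}
    (H : ∀ n, N ≤ n → h (n + 2) - 2 * h (n + 1) + h n = e) :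
    ∃ P : ℚ[X], (∀ n, N ≤ n → P.eval (n : ℚ) = h n) ∧
      ∀ t : ℚ, P.eval (t + 2) - 2 * P.eval (t + 1) + P.eval t = e := by
  -- Newton's interpolation at N and N + 1, with second difference e.
  let P : ℚ[X] := C (h N) + (X - C (N : ℚ)) * C (h (N + 1) - h N) +
    C (e / 2) * (X - C (N : ℚ)) * (X - C (N : ℚ) - 1)
  have hP : ∀ t : ℚ, P.eval t = h N + (t - N) * (h (N + 1) - h N) +
      e / 2 * (t - N) * (t - N - 1) := by
    intro t
    simp [P]
  refine ⟨P, ?_, fun t => by rw [hP, hP, hP]; ring⟩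
  have key : ∀ k : ℕ, P.eval ((N + k : ℤ) : ℚ) = h (N + k) ∧
      P.eval ((N + k + 1 : ℤ) : ℚ) = h (N + k + 1) := by
    intro k
    induction k with
    | zero =>
      constructor
      · rw [hP]; simp
      · rw [hP]; simp
    | succ k ih =>
      obtain ⟨h1, h2⟩ := ih
      have h3 := H (N + k) (by omega)
      rw [hP] at h1 h2 ⊢
      refine ⟨?_, ?_⟩
      · rw [show N + ((k + 1 : ℕ) : ℤ) = N + k + 1 by push_cast; ring, ← h2]
      · rw [hP, show N + ((k + 1 : ℕ) : ℤ) + 1 = N + k + 2 by push_cast; ring]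
        push_cast at h1 h2 ⊢
        linear_combination 2 * h2 - h1 - h3
  intro n hn
  obtain ⟨k, rfl⟩ := Int.le.dest hn
  exact (key k).1

theorem hilbertPolynomial_eq {I : Ideal R} {P : ℚ[X]} (hP : IsHilbertPolynomial I P) :
    hilbertPolynomial I = P := by
  have hex : ∃ P : ℚ[X], IsHilbertPolynomial I P := ⟨P, hP⟩
  rw [hilbertPolynomial, dif_pos hex]
  exact hex.choose_spec.unique hP

/-- Beyond the postulation number the Hilbert-Samuel polynomial and function agree. -/
theorem eval_hilbertPolynomial_of_postulationNumber_lt {I : Ideal R} {P : ℚ[X]}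
    (hP : IsHilbertPolynomial I P) {t : ℤ} (ht : postulationNumber I < t) :
    (hilbertPolynomial I).eval (t : ℚ) = (hilbertFunction I t : ℚ) := by
  set S : Set ℤ := {n : ℤ | ∀ t : ℤ, n < t →
    (hilbertPolynomial I).eval (t : ℚ) = (hilbertFunction I t : ℚ)}
  have hne : S.Nonempty := by
    obtain ⟨N, hN⟩ := hP
    refine ⟨N, fun t ht => ?_⟩
    rw [hilbertPolynomial_eq ⟨N, hN⟩]
    exact hN t ht.le
  by_cases hb : BddBelow S
  · exact Int.csInf_mem hne hb t ht
  -- Here `sInf` is a default value, but some member of S lies below t anyway.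
  · obtain ⟨n, hn, hnt⟩ := not_bddBelow_iff.mp hb t
    exact hn t hnt

end HilbertPolynomial

/-! ### Ratliff-Rush closure, superficial elements and colons -/

section RatliffRush

variable {R : Type*} [CommRing R]

theorem le_ratliffRush (I : Ideal R) : I ≤ ratliffRush I := by
  refine le_trans ?_ (le_iSup₂ (f := fun (n : ℕ) (_ : n ∈ {n : ℕ | 1 ≤ n}) =>
    Submodule.colon (I ^ (n + 1)) ((I ^ n : Ideal R) : Set R)) 1 (le_refl 1))
  intro a ha
  rw [Submodule.mem_colon]
  intro s hs
  rw [smul_eq_mul, pow_succ']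
  exact Ideal.mul_mem_mul ha hs

/-- If a multiplies (I^n)^k into (I^n)^(k+1), test it on x^(nk) and cancel the factors x one at a
time. -/
theorem ratliffRush_pow_le {I : Ideal R} {x : R} (hxI : x ∈ I) {n : ℕ}
    (h : ∀ m, n ≤ m → ∀ a, a * x ∈ I ^ (m + 1) → a ∈ I ^ m) : ratliffRush (I ^ n) ≤ I ^ n := by
  have key : ∀ j : ℕ, ∀ a, a * x ^ j ∈ I ^ (n + j) → a ∈ I ^ n := by
    intro j
    induction j with
    | zero => intro a ha; simpa using ha
    | succ j ih =>
      intro a ha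
      refine ih a (h (n + j) (by omega) _ ?_)
      rwa [mul_assoc, ← pow_succ, add_assoc]
  refine iSup₂_le fun k _ a ha => ?_
  rw [Submodule.mem_colon] at ha
  have hx : x ^ (n * k) ∈ (I ^ n) ^ k := by
    rw [← pow_mul]
    exact Ideal.pow_mem_pow hxI _
  have := ha _ hx
  rw [smul_eq_mul, ← pow_mul] at this
  refine key (n * k) a ?_
  rwa [show n + n * k = n * (k + 1) by ring]

/-- For a superficial nonzerodivisor, `(I ^ (n + 1) : x) = I ^ n` for all large `n`. -/
theorem IsSuperficial.exists_mem_pow_of_mul_mem [IsNoetherianRing R] {I : Ideal R} {x : R}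
    (hx : IsSuperficial I x) (hreg : ∀ z, x * z = 0 → z = 0) :
    ∃ n₀ : ℕ, ∀ n, n₀ ≤ n → ∀ a, a * x ∈ I ^ (n + 1) → a ∈ I ^ n := by
  obtain ⟨-, c, -, hc⟩ := hx
  obtain ⟨k, hk⟩ := Ideal.exists_pow_inf_eq_pow_smul I (Ideal.span {x})
  refine ⟨c + k, fun n hn a ha => ?_⟩
  -- Artin-Rees places ax in I^(n+1-k) x; cancelling x puts a in I^(n+1-k), which lies in I^c.
  have hac : a ∈ I ^ c := by
    have h1 : a * x ∈ I ^ (n + 1) • (⊤ : Ideal R) ⊓ Ideal.span {x} :=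
      ⟨by simpa using ha, Ideal.mem_span_singleton.mpr (Dvd.intro_left a rfl)⟩
    rw [hk (n + 1) (by omega)] at h1
    have h2 : a * x ∈ I ^ (n + 1 - k) * Ideal.span {x} :=
      Ideal.mul_mono_right inf_le_right h1
    obtain ⟨w, hw, hwx⟩ := Ideal.mem_mul_span_singleton.mp h2
    have : a = w := by
      rw [← sub_eq_zero]
      apply hreg
      linear_combination -hwx
    rw [this]
    exact Ideal.pow_le_pow_right (by omega) hw
  rw [← hc n (by omega)]
  exact ⟨Submodule.mem_colon_singleton.mpr ha, hac⟩

/-- The stability index is attained when the Ratliff-Rush filtration stabilises. -/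
theorem stabilityIndex_spec {I : Ideal R} {x : R} (hxI : x ∈ I) {n₀ : ℕ}
    (h : ∀ n, n₀ ≤ n → ∀ a, a * x ∈ I ^ (n + 1) → a ∈ I ^ n) :
    1 ≤ stabilityIndex I ∧ ∀ n : ℕ, stabilityIndex I ≤ n → ratliffRush (I ^ n) = I ^ n :=
  Nat.sInf_mem (s := {i : ℕ | 1 ≤ i ∧ ∀ n : ℕ, i ≤ n → ratliffRush (I ^ n) = I ^ n})
    ⟨n₀ + 1, by omega, fun n hn => le_antisymm
      (ratliffRush_pow_le hxI fun m hm => h m (by omega)) (le_ratliffRush _)⟩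

theorem mul_pow_eq_of_le {I J : Ideal R} {m n : ℕ} (h : J * I ^ m = I ^ (m + 1)) (hmn : m ≤ n) :
    J * I ^ n = I ^ (n + 1) := by
  obtain ⟨k, rfl⟩ := Nat.exists_eq_add_of_le hmn
  rw [pow_add, ← mul_assoc, h, ← pow_add]
  congr 1
  omega

/-- Colons by a reduction land in the Ratliff-Rush closure. -/
theorem colon_le_ratliffRush {I J : Ideal R} (hJ : IsReduction I J) {n : ℕ} (hn : 1 ≤ n) :
    Submodule.colon (I ^ (n + 1)) (J : Set R) ≤ ratliffRush (I ^ n) := by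
  obtain ⟨-, m, hm⟩ := hJ
  refine le_trans ?_ (le_iSup₂ (f := fun (k : ℕ) (_ : k ∈ {k : ℕ | 1 ≤ k}) =>
    Submodule.colon ((I ^ n) ^ (k + 1)) (((I ^ n) ^ k : Ideal R) : Set R)) (m + 1)
      (Nat.succ_le_succ (Nat.zero_le m)))
  intro a ha
  rw [Submodule.mem_colon] at ha ⊢
  have hle : m + 1 ≤ n * (m + 1) := Nat.le_mul_of_pos_left _ hn
  -- Since l = n(m+1) - 1 ≥ m, (I^n)^(m+1) = J I^l, which a sends into I^(n+1+l) = (I^n)^(m+2).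
  obtain ⟨l, hl⟩ := Nat.exists_eq_add_of_le' (show 1 ≤ n * (m + 1) by omega)
  intro s hs
  rw [← pow_mul, hl, ← mul_pow_eq_of_le hm (show m ≤ l by omega)] at hs
  have hdist : Ideal.span {a} * (J * I ^ l) ≤ I ^ (n + 1) * I ^ l := by
    rw [← mul_assoc]
    refine Ideal.mul_mono_left (Ideal.span_singleton_mul_le_iff.mpr fun j hj => ?_)
    exact ha j hj
  have h := hdist (Ideal.mul_mem_mul (Ideal.mem_span_singleton_self a) hs)
  rw [← pow_add] at h
  rw [smul_eq_mul, ← pow_mul]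
  convert h using 2
  rw [Nat.mul_succ]
  omega

theorem colon_eq_pow {I J : Ideal R} (hJ : IsReduction I J) {n : ℕ} (hn : 1 ≤ n)
    (hr : ratliffRush (I ^ n) = I ^ n) : Submodule.colon (I ^ (n + 1)) (J : Set R) = I ^ n := by
  refine le_antisymm ((colon_le_ratliffRush hJ hn).trans hr.le) fun a ha => ?_
  rw [Submodule.mem_colon]
  intro s hs
  rw [smul_eq_mul, pow_succ]
  exact Ideal.mul_mem_mul ha (hJ.1 hs)

end RatliffRush

end HilbertSamuel

/-! ### The main theorem -/

theorem theorem3p6 {R : Type*} [CommRing R] [IsLocalRing R]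
    (hCM : HilbertSamuel.IsCohenMacaulayLocal R) (hdim : ringKrullDim R = 2)
    (I : Ideal R) (hI : HilbertSamuel.IsMPrimary I)
    (J : Ideal R) (x y : R) (hJxy : J = Ideal.span {x, y})
    (hJ : HilbertSamuel.IsMinimalReduction I J)
    (hx : HilbertSamuel.IsSuperficial I x)
    (hn : HilbertSamuel.postulationNumber I = (HilbertSamuel.stabilityIndex I : ℤ) - 1) :
    (HilbertSamuel.reductionNumber I : ℤ) ≤ HilbertSamuel.postulationNumber I + 2 ∧
      HilbertSamuel.reductionNumberWrt I J ≤ HilbertSamuel.stabilityIndex I + 1 := by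
  open HilbertSamuel in
  have := hCM.noetherian
  have hred : IsReduction I J := hJ.1
  have hdepth : 2 ≤ depth R := by
    have h := hCM.depth_eq_dim
    rw [hdim] at h
    exact WithBot.coe_le_coe.mp h.ge
  have hIm : I ≤ IsLocalRing.maximalIdeal R := IsLocalRing.le_maximalIdeal hI.1.1
  obtain ⟨k, hk⟩ : ∃ k, IsLocalRing.maximalIdeal R ^ k ≤ I := by
    rw [← hI.2]
    exact I.exists_radical_pow_le_of_fg (IsNoetherian.noetherian _)
  obtain ⟨r, hr⟩ := hred.2
  have hkn : ∀ n, IsLocalRing.maximalIdeal R ^ (k * n) ≤ I ^ n := fun n => by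
    rw [pow_mul]
    exact Ideal.pow_right_mono hk n
  have hkJ : IsLocalRing.maximalIdeal R ^ (k * (r + 1)) ≤ J :=
    (hkn (r + 1)).trans (hr ▸ Ideal.mul_le_inf.trans inf_le_left)
  have hK : ∀ p q, x * p + y * q = 0 → ∃ c, p = y * c ∧ q = -(x * c) := fun p q =>
    exists_koszul_syzygy_of_depth hdepth (hJxy ▸ hkJ)
  have hyJ : y ∈ J := hJxy ▸ Ideal.subset_span (by simp)
  have hreg : ∀ z, x * z = 0 → z = 0 := fun z =>
    eq_zero_of_mul_eq_zero_of_koszul (hIm (hred.1 hyJ)) hK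
  obtain ⟨n₀, hn₀⟩ := hx.exists_mem_pow_of_mul_mem hreg
  obtain ⟨hρ1, hρ⟩ := stabilityIndex_spec hx.1 hn₀
  set ρ := stabilityIndex I
  have hcolon : ∀ n, ρ ≤ n → Submodule.colon (I ^ (n + 1)) (J : Set R) = I ^ n := fun n hn =>
    colon_eq_pow hred (hρ1.trans hn) (hρ n hn)
  have hfinI : ∀ n, Module.length R (R ⧸ I ^ n) ≠ ⊤ := fun n => length_quotient_ne_top (hkn n)
  have hH : ∀ n : ℕ, ((hilbertFunction I n : ℕ) : ℕ∞) = Module.length R (R ⧸ I ^ n) := fun n => by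
    rw [hilbertFunction, Int.toNat_natCast, ENat.natCast_toNat (hfinI n)]
  obtain ⟨e, he⟩ := ENat.ne_top_iff_exists.mp (length_quotient_ne_top hkJ)
  have hlen : ∀ n, ρ ≤ n → Module.length R (R ⧸ J * I ^ (n + 1)) + hilbertFunction I n =
      (e : ℕ∞) + (hilbertFunction I (n + 1 : ℕ) + hilbertFunction I (n + 1 : ℕ)) := fun n hn => by
    have h := length_quotient_mul_add (I ^ (n + 1)) hK
    rw [← hJxy, hcolon n hn, ← hH n, ← hH (n + 1), ← he] at h
    exact h
  -- n ≥ ρ identifies the colon with I^n; n ≥ r gives J I^(n+1) = I^(n+2).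
  have hdiff : ∀ n : ℤ, (max ρ r : ℤ) ≤ n → (hilbertFunction I (n + 2) : ℚ) -
      2 * hilbertFunction I (n + 1) + hilbertFunction I n = e := by
    intro n hn
    obtain ⟨n, rfl⟩ := Int.eq_ofNat_of_zero_le (show 0 ≤ n by omega)
    have h := hlen n (by omega)
    rw [mul_pow_eq_of_le hr (show r ≤ n + 1 by omega), ← hH] at h
    have h' : hilbertFunction I (n + 1 + 1 : ℕ) + hilbertFunction I n =
      e + (hilbertFunction I (n + 1 : ℕ) + hilbertFunction I (n + 1 : ℕ)) := by exact_mod_cast h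
    have h'' : ((hilbertFunction I (n + 1 + 1 : ℕ) : ℚ)) + hilbertFunction I n =
      e + (hilbertFunction I (n + 1 : ℕ) + hilbertFunction I (n + 1 : ℕ)) := by exact_mod_cast h'
    rw [show (n : ℤ) + 2 = ((n + 1 + 1 : ℕ) : ℤ) by push_cast; ring,
      show (n : ℤ) + 1 = ((n + 1 : ℕ) : ℤ) by push_cast; ring]
    linear_combination h''
  obtain ⟨P, hPH, hP2⟩ := exists_polynomial_of_second_difference
    (h := fun n => (hilbertFunction I n : ℚ)) hdiff
  have hP : IsHilbertPolynomial I P := ⟨_, hPH⟩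
  have hpost : ∀ n : ℕ, ρ ≤ n → P.eval (n : ℚ) = hilbertFunction I n := fun n hn' => by
    have h := eval_hilbertPolynomial_of_postulationNumber_lt hP (t := (n : ℤ)) (by omega)
    rw [hilbertPolynomial_eq hP] at h
    exact_mod_cast h
  have hmain : J * I ^ (ρ + 1) = I ^ (ρ + 2) := by
    refine eq_of_le_of_length_quotient_eq ?_ (hfinI _) ?_
    · rw [pow_succ' I (ρ + 1)]
      exact Ideal.mul_mono_left hred.1
    · have h := hlen ρ le_rfl
      have h2 := hP2 (ρ : ℚ)
      have h3 := hpost (ρ + 1) (by omega)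
      -- The identity for P holds at ρ even when ρ < r; P = H at ρ, ρ + 1 and ρ + 2 transfers it to
      -- H.
      have h4 := hpost (ρ + 2) (by omega)
      have h5 := hpost ρ le_rfl
      push_cast at h3 h4
      rw [h3, h4, h5] at h2
      have h6 : hilbertFunction I (ρ + 2 : ℕ) + hilbertFunction I ρ =
          e + (hilbertFunction I (ρ + 1 : ℕ) + hilbertFunction I (ρ + 1 : ℕ)) := by
        have : (hilbertFunction I (ρ + 2 : ℕ) + hilbertFunction I ρ : ℚ) =
          e + (hilbertFunction I (ρ + 1 : ℕ) + hilbertFunction I (ρ + 1 : ℕ)) := by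
          push_cast
          linear_combination h2
        exact_mod_cast this
      rw [← hH]
      refine (ENat.addLECancellable_of_ne_top (ENat.natCast_ne_top (hilbertFunction I ρ))).inj_left.mp ?_
      rw [h]
      exact_mod_cast h6.symm
  have hrd : reductionNumberWrt I J ≤ ρ + 1 := Nat.sInf_le hmain
  refine ⟨?_, hrd⟩
  have hle : reductionNumber I ≤ reductionNumberWrt I J := Nat.sInf_le ⟨J, hJ, rfl⟩
  rw [hn]
  omega
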